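/- **Setting.** Let $\{f(\cdot\mid\theta):\theta\in\Theta\}$, with $\Theta\subseteq\mathbb R^p$ measurable, be a family of probability densities with respect to a common measure on a measurable space $\mathcal X$, let $\theta^*$ be an interior point of $\Theta$, and let $X_1,X_2,\dots$ be i.i.d. with density $f(\cdot\mid\theta^*)$; $P_0$ denotes their law. Let $\boldsymbol\alpha=(\alpha_i)_{i\ge1}$ be a sequence of positive constants with finite second moment, $\limsup_{n}\frac1n\sum_{i=1}^n\alpha_i^2<\infty$, and put $\bar\alpha_n=\frac1n\sum_{i=1}^n\alpha_i$. Let $\rho:\mathcal X\times\Theta\to\mathbb R$ be a measurable loss with score function $\psi(x,\theta)=\partial\rho(x,\theta)/\partial\theta$ (wherever, in the interior of $\Theta$, this derivative exists), and let $\hat\theta^{\boldsymbol\alpha}_\rho=\hat\theta^{\boldsymbol\alpha}_{\rho,n}$ be a weighted M-estimator, i.e. with $P_0$-probability tending to one it lies in $\Theta$ and satisfies $\frac1n\sum_{i=1}^n\alpha_i\psi(X_i,\hat\theta^{\boldsymbol\alpha}_\rho)=0$. Let $\pi\ge0$ be a measurable prior density on $\Theta$, possibly improper, and let the weighted M-posterior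 be the probability measure on $\Theta$ with density $$\pi^\rho_n(\theta\mid F_n^{\boldsymbol\alpha})=\frac{\exp\bigl(-\sum_{i=1}^n\alpha_i\rho(X_i,\theta)\bigr)\pi(\theta)}{\int_\Theta\exp\bigl(-\sum_{i=1}^n\alpha_i\rho(X_i,\theta')\bigr)\pi(\theta')\,d\theta'},$$ where the denominator is assumed finite with $P_0$-probability tending to one (which is automatic if $\rho\ge0$ and $\int_\Theta\pi<\infty$). **Theorem.** Suppose that $\pi$ is continuous and positive on a neighbourhood of $\theta^*$, and that: 1. (Weighted M-LAN) $V_{\theta^*}$ is a positive definite $p\times p$ matrix such that $$R_{n,\boldsymbol\alpha}(h)=\sum_{i=1}^n\alpha_i\bigl(\rho(X_i,\theta^*)-\rho(X_i,\theta^*+h/\sqrt n)\bigr)-\bar\alpha_n\,h^\top V_{\theta^*}\sqrt n\,(\hat\theta^{\boldsymbol\alpha}_\rho-\theta^*)+\tfrac12\,\bar\alpha_n\,h^\top V_{\theta^*}h$$ satisfies $\sup_{h\in K}|R_{n,\boldsymbol\alpha}(h)|\to0$ in $P_0$-probability for every compact $K\subseteq\mathbb R^p$. 2. ($\sqrt n$-concentration)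 For every sequence of constants $r_n\to\infty$, $$\mathbb E_{P_0}\Bigl[\int_\Theta\mathbf 1\{\|\sqrt n(\theta-\theta^*)\|>r_n\}\,\pi^\rho_n(\theta\mid F_n^{\boldsymbol\alpha})\,d\theta\Bigr]\to0.$$ Then, with $d_{\mathrm{TV}}(\mu,\nu)=\sup_A|\mu(A)-\nu(A)|$ (supremum over Borel sets $A\subseteq\mathbb R^p$), $$d_{\mathrm{TV}}\Bigl(\pi^\rho_n(\cdot\mid F_n^{\boldsymbol\alpha}),\;N\bigl(\hat\theta^{\boldsymbol\alpha}_\rho,\;V_{\theta^*}^{-1}/(\bar\alpha_n n)\bigr)\Bigr)\to0\quad\text{in }P_0\text{-probability}.$$ -/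

import Mathlib

open MeasureTheory ProbabilityTheory Filter Topology
open scoped ENNReal Matrix

noncomputable section

namespace MPosterior

/-- Euclidean space `ℝ^p`. -/
abbrev E (p : ℕ) : Type := EuclideanSpace ℝ (Fin p)

/-- A parametric family `{f(· ∣ θ) : θ ∈ Θ}` of probability densities on the sample space `𝒳`, with
respect to a common reference measure, indexed by a measurable set `Θ ⊆ ℝ^p`. -/
structure ParametricModel (𝒳 : Type*) [MeasurableSpace 𝒳] (p : ℕ) where
  /-- The parameter space `Θ`. -/
  paramSpace : Set (E p)
  measurableSet_paramSpace : MeasurableSet paramSpace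
  /-- The reference measure. -/
  base : Measure 𝒳
  /-- The densities `f(x ∣ θ)`, written `density θ x`. -/
  density : E p → 𝒳 → ℝ≥0∞
  measurable_density : ∀ θ ∈ paramSpace, Measurable (density θ)
  lintegral_density : ∀ θ ∈ paramSpace, ∫⁻ x, density θ x ∂base = 1

/-- The distribution with density `f(· ∣ θ)`. -/
def ParametricModel.dist {𝒳 : Type*} [MeasurableSpace 𝒳] {p : ℕ}
    (M : ParametricModel 𝒳 p) (θ : E p) : Measure 𝒳 :=
  M.base.withDensity (M.density θ)

/-- A sequence of positive weights with finite second moment: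
`limsup_n n⁻¹ ∑_{i ≤ n} α_i² < ∞`.  The weights are indexed from `0`. -/
def AdmissibleWeights (α : ℕ → ℝ) : Prop :=
  (∀ i, 0 < α i) ∧
    IsBoundedUnder (· ≤ ·) atTop fun n : ℕ => (∑ i ∈ Finset.range n, α i ^ 2) / (n : ℝ)

/-- The average `n⁻¹ ∑_{i ≤ n} α_i` of the first `n` weights. -/
def avgWeight (α : ℕ → ℝ) (n : ℕ) : ℝ := (∑ i ∈ Finset.range n, α i) / (n : ℝ)

section Finite

variable {𝒳 : Type*} {p : ℕ}

/-- The total weighted loss `∑_{i ≤ n} α_i ρ(x_i, θ)` of the data `x_1, …, x_n`; it is `n` times the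
integral of `ρ(·, θ)` against the weighted empirical measure `n⁻¹ ∑_{i ≤ n} α_i δ_{x_i}`. -/
def weightedLoss (ρ : 𝒳 → E p → ℝ) (α : ℕ → ℝ) (n : ℕ) (x : ℕ → 𝒳) (θ : E p) : ℝ :=
  ∑ i ∈ Finset.range n, α i * ρ (x i) θ

/-- The unnormalised weighted M-posterior: density `exp(-∑ α_i ρ(x_i, θ)) π(θ)` on `Θ`. -/
def unnormalizedPosterior (Θ : Set (E p)) (ρ : 𝒳 → E p → ℝ) (π : E p → ℝ) (α : ℕ → ℝ)
    (n : ℕ) (x : ℕ → 𝒳) : Measure (E p) :=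
  (volume.restrict Θ).withDensity fun θ =>
    ENNReal.ofReal (Real.exp (-weightedLoss ρ α n x θ) * π θ)

/-- The normalising constant `∫_Θ exp(-∑ α_i ρ(x_i, θ)) π(θ) dθ`, in `[0, ∞]`. -/
def normalizer (Θ : Set (E p)) (ρ : 𝒳 → E p → ℝ) (π : E p → ℝ) (α : ℕ → ℝ)
    (n : ℕ) (x : ℕ → 𝒳) : ℝ≥0∞ :=
  ∫⁻ θ in Θ, ENNReal.ofReal (Real.exp (-weightedLoss ρ α n x θ) * π θ)

/-- The weighted M-posterior, as a measure on `ℝ^p` carried by `Θ`. -/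
def posterior (Θ : Set (E p)) (ρ : 𝒳 → E p → ℝ) (π : E p → ℝ) (α : ℕ → ℝ)
    (n : ℕ) (x : ℕ → 𝒳) : Measure (E p) :=
  (normalizer Θ ρ π α n x)⁻¹ • unnormalizedPosterior Θ ρ π α n x

/-- `ψ` is a score function of the loss `ρ`: `ψ(x, θ) = ∂ρ(x, θ)/∂θ` wherever this derivative exists
in the interior of `Θ`.  Where a loss such as `|x - θ|` has a kink, `ψ` is free. -/
def IsScore (Θ : Set (E p)) (ρ : 𝒳 → E p → ℝ) (ψ : 𝒳 → E p → E p) : Prop :=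
  ∀ x, ∀ θ ∈ interior Θ, ∀ g, HasGradientAt (ρ x) g θ → ψ x θ = g

/-- `t` is a weighted M-estimate for the data `x_1, …, x_n`: a point of `Θ` that solves
`n⁻¹ ∑_{i ≤ n} α_i ψ(x_i, t) = 0`. -/
def IsWeightedMEstimate (Θ : Set (E p)) (ψ : 𝒳 → E p → E p) (α : ℕ → ℝ)
    (n : ℕ) (x : ℕ → 𝒳) (t : E p) : Prop :=
  t ∈ Θ ∧ (n : ℝ)⁻¹ • ∑ i ∈ Finset.range n, α i • ψ (x i) t = 0

/-- The remainder
`∑ α_i (ρ(x_i, θ⋆) - ρ(x_i, θ⋆ + h/√n)) - ᾱ_n hᵀ V √n (t - θ⋆) + ½ ᾱ_n hᵀ V h`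
of the quadratic expansion of the weighted loss around `θ⋆` with centring `t`. -/
def lanRemainder (ρ : 𝒳 → E p → ℝ) (α : ℕ → ℝ) (θstar : E p) (V : Matrix (Fin p) (Fin p) ℝ)
    (n : ℕ) (x : ℕ → 𝒳) (t h : E p) : ℝ :=
  (∑ i ∈ Finset.range n, α i * (ρ (x i) θstar - ρ (x i) (θstar + (√(n : ℝ))⁻¹ • h)))
    - avgWeight α n * (h.ofLp ⬝ᵥ V *ᵥ (√(n : ℝ) • (t - θstar)).ofLp)
    + 1 / 2 * (avgWeight α n * (h.ofLp ⬝ᵥ V *ᵥ h.ofLp))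

end Finite

/-- The total variation distance `sup_A |μ(A) - ν(A)|` of two finite measures, the supremum being
over measurable sets. -/
def tvDist {S : Type*} [MeasurableSpace S] (μ ν : Measure S) : ℝ :=
  ⨆ A : {A : Set S // MeasurableSet A}, |μ.real A - ν.real A|

section Stochastic

variable {Ω : Type*} [MeasurableSpace Ω] {𝒳 : Type*} {p : ℕ}

/-- `θhat n` is a weighted M-estimator based on `X_1, …, X_n`: a solution in `Θ` of the weighted
estimating equation, with probability tending to one. -/
def IsWeightedMEstimator (P : Measure Ω) (X : ℕ → Ω → 𝒳) (Θ : Set (E p)) (ψ : 𝒳 → E p → E p)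
    (α : ℕ → ℝ) (θhat : ℕ → Ω → E p) : Prop :=
  Tendsto
    (fun n => P {ω | ¬ IsWeightedMEstimate Θ ψ α n (fun i => X i ω) (θhat n ω)}) atTop (𝓝 0)

/-- The weighted M-LAN condition at `θ⋆` with matrix `V`, for the weights `α`: the remainder tends
to zero in probability, uniformly over `h` in compact sets. -/
def WeightedMLAN (P : Measure Ω) (X : ℕ → Ω → 𝒳) (ρ : 𝒳 → E p → ℝ) (α : ℕ → ℝ) (θstar : E p)
    (V : Matrix (Fin p) (Fin p) ℝ) (θhat : ℕ → Ω → E p) : Prop :=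
  V.PosDef ∧ ∀ K : Set (E p), IsCompact K → ∀ ε : ℝ≥0∞, 0 < ε →
    Tendsto (fun n => P {ω | ε <
        ⨆ h ∈ K, ‖lanRemainder ρ α θstar V n (fun i => X i ω) (θhat n ω) h‖ₑ}) atTop (𝓝 0)

/-- The weighted M-posterior concentrates at rate `√n` around `θ⋆`: for every `r_n → ∞`, the expected
posterior mass of `{θ : ‖√n (θ - θ⋆)‖ > r_n}` tends to zero. -/
def ConcentratesAtRootN (P : Measure Ω) (X : ℕ → Ω → 𝒳) (Θ : Set (E p)) (ρ : 𝒳 → E p → ℝ)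
    (π : E p → ℝ) (α : ℕ → ℝ) (θstar : E p) : Prop :=
  ∀ r : ℕ → ℝ, Tendsto r atTop atTop →
    Tendsto (fun n => ∫⁻ ω, posterior Θ ρ π α n (fun i => X i ω)
        {θ | r n < ‖√(n : ℝ) • (θ - θstar)‖} ∂P) atTop (𝓝 0)

/-- The weighted M-posterior exists (its normalising constant is finite) with probability tending to
one.  This is automatic for a nonnegative loss and an integrable prior density, see
`normalizer_lt_top`. -/
def PosteriorExists (P : Measure Ω) (X : ℕ → Ω → 𝒳) (Θ : Set (E p)) (ρ : 𝒳 → E p → ℝ)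
    (π : E p → ℝ) (α : ℕ → ℝ) : Prop :=
  Tendsto (fun n => P {ω | normalizer Θ ρ π α n (fun i => X i ω) = ∞}) atTop (𝓝 0)

end Stochastic

theorem normalizer_lt_top {𝒳 : Type*} {p : ℕ} {Θ : Set (E p)} (hΘ : MeasurableSet Θ)
    {ρ : 𝒳 → E p → ℝ} (hρ : ∀ x, ∀ θ ∈ Θ, 0 ≤ ρ x θ) {π : E p → ℝ} (hπ : ∀ θ ∈ Θ, 0 ≤ π θ)
    (hint : IntegrableOn π Θ) {α : ℕ → ℝ} (hα : ∀ i, 0 < α i) (n : ℕ) (x : ℕ → 𝒳) :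
    normalizer Θ ρ π α n x < ∞ := by
  refine lt_of_le_of_lt (setLIntegral_mono_ae' hΘ (g := fun θ => ENNReal.ofReal (π θ))
    (Eventually.of_forall fun θ hθ => ENNReal.ofReal_le_ofReal ?_)) hint.lintegral_lt_top
  have h0 : 0 ≤ weightedLoss ρ α n x θ :=
    Finset.sum_nonneg fun i _ => mul_nonneg (hα i).le (hρ _ _ hθ)
  exact mul_le_of_le_one_left (hπ θ hθ) (Real.exp_le_one_iff.2 (by linarith))

end MPosterior

end

/-! Completing the square in the M-LAN expansion turns the posterior weight, on balls around θ⋆ with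
radius of order 1/√n, into a constant times the Gaussian density with mean θ̂ and precision matrix b
V, where b = n ᾱ_n, up to a factor close to one (`neg_weightedLoss_eq`, `posteriorWeight_bounds`).
On such balls the posterior is therefore nearly proportional to the Gaussian measure. Concentration
puts nearly all posterior mass in one of them, and it remains to see that the Gaussian mass is also
there.

Neither tightness of √n (θ̂ - θ⋆) nor a positive lower bound for ᾱ_n is given, so the Gaussian could
in principle drift away or flatten out. `exists_gaussian_localization` excludes both. If the mean
were far from the ball, or the Gaussian nearly flat at its scale, a disjoint translate of the ball
would have at least a fixed large fraction of the Gaussian mass of the ball; by near proportionality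
the same holds for the posterior, and the two balls together would carry mass above one.

With mean and standard deviation controlled by the radius r, the Gaussian is tight on a ball of
radius ℓ r (`exists_gaussian_closedBall_ge`), and near proportionality on a set carrying most of
both masses gives closeness in total variation (`tvDist_le_of_nearly_proportional`). The multiple ℓ
depends only on V and ε, so it is fixed before the radius and before n. -/

namespace MPosterior

open scoped RealInnerProductSpace MatrixOrder

/-! ### Densities of Gaussian measures -/

/-- The standard Gaussian measure has a density proportional to `exp (-‖x‖² / 2)`. -/
theorem exists_stdGaussian_eq_smul_withDensity (F : Type*) [NormedAddCommGroup F]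
    [InnerProductSpace ℝ F] [FiniteDimensional ℝ F] [MeasurableSpace F] [BorelSpace F] :
    ∃ c : ℝ≥0∞, c ≠ 0 ∧ c ≠ ∞ ∧ stdGaussian F =
      c • volume.withDensity fun x : F => ENNReal.ofReal (Real.exp (-(1 / 2) * ‖x‖ ^ 2)) := by
  set C : ℝ := (Real.pi / (1 / 2)) ^ (Module.finrank ℝ F / 2 : ℝ) with hC
  have hCpos : 0 < C := by positivity
  have hint : Integrable fun x : F => Real.exp (-(1 / 2) * ‖x‖ ^ 2) := by
    have := (GaussianFourier.integrable_cexp_neg_mul_sq_norm_add (V := F) (b := (1 / 2 : ℝ))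
      (by norm_num) 0 0).re
    refine this.congr (Eventually.of_forall fun x => ?_)
    have : (-((1 / 2 : ℝ) : ℂ) * (‖x‖ : ℂ) ^ 2 + 0 * ((⟪(0 : F), x⟫ : ℝ) : ℂ)) =
      ((-(1 / 2) * ‖x‖ ^ 2 : ℝ) : ℂ) := by push_cast; ring
    simp only [RCLike.re_to_complex]
    rw [this, ← Complex.ofReal_exp, Complex.ofReal_re]
  refine ⟨ENNReal.ofReal C⁻¹, by simpa using hCpos, ENNReal.ofReal_ne_top, ?_⟩
  have : IsFiniteMeasure (volume.withDensity fun x : F =>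
      ENNReal.ofReal (Real.exp (-(1 / 2) * ‖x‖ ^ 2))) :=
    isFiniteMeasure_withDensity_ofReal hint.2
  have : IsFiniteMeasure (ENNReal.ofReal C⁻¹ • volume.withDensity fun x : F =>
      ENNReal.ofReal (Real.exp (-(1 / 2) * ‖x‖ ^ 2))) :=
    Measure.smul_finite _ ENNReal.ofReal_ne_top
  -- Comparing characteristic functions identifies the shape of the density and its normalising
  -- constant `C⁻¹` at once.
  apply Measure.ext_of_charFun
  ext t
  rw [charFun_stdGaussian, charFun_apply, integral_smul_measure,
    integral_withDensity_eq_integral_toReal_smul (by fun_prop)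
      (Eventually.of_forall fun _ => ENNReal.ofReal_lt_top)]
  have key := GaussianFourier.integral_cexp_neg_mul_sq_norm_add (V := F) (b := (1 / 2 : ℝ))
    (by norm_num) Complex.I t
  have hrw : (∫ x : F, (ENNReal.ofReal (Real.exp (-(1 / 2) * ‖x‖ ^ 2))).toReal •
      Complex.exp ((⟪x, t⟫ : ℝ) * Complex.I)) =
      (C : ℂ) * Complex.exp (-‖t‖ ^ 2 / 2) := by
    rw [hC]
    have e1 : (((Real.pi / (1 / 2)) ^ (Module.finrank ℝ F / 2 : ℝ) : ℝ) : ℂ) =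
        (Real.pi / ((1 / 2 : ℝ) : ℂ)) ^ (Module.finrank ℝ F / 2 : ℂ) := by
      rw [Complex.ofReal_cpow (by positivity)]; push_cast; rfl
    rw [e1]
    convert key using 1
    · refine integral_congr_ae (Eventually.of_forall fun x => ?_)
      simp only
      rw [ENNReal.toReal_ofReal (Real.exp_pos _).le, Complex.real_smul, Complex.ofReal_exp,
        ← Complex.exp_add, real_inner_comm]
      congr 1
      push_cast
      ring
    · congr 2
      rw [Complex.I_sq]
      push_cast
      ring
  rw [hrw, ENNReal.toReal_ofReal (by positivity), Complex.real_smul, ← mul_assoc,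
    ← Complex.ofReal_mul, inv_mul_cancel₀ hCpos.ne', Complex.ofReal_one, one_mul]

/-- A nondegenerate Gaussian measure has a density proportional to
`exp (-(x - t)ᵀ S⁻¹ (x - t) / 2)`. -/
theorem exists_multivariateGaussian_eq_smul_withDensity {p : ℕ} (t : E p)
    {S : Matrix (Fin p) (Fin p) ℝ} (hS : S.PosDef) :
    ∃ c : ℝ≥0∞, c ≠ 0 ∧ c ≠ ∞ ∧ multivariateGaussian t S =
      c • volume.withDensity fun x : E p => ENNReal.ofReal
        (Real.exp (-(1 / 2) * ⟪x - t, Matrix.toEuclideanCLM (𝕜 := ℝ) S⁻¹ (x - t)⟫)) := by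
  obtain ⟨c, hc0, hct, hc⟩ := exists_stdGaussian_eq_smul_withDensity (E p)
  set A : E p →L[ℝ] E p := Matrix.toEuclideanCLM (𝕜 := ℝ) (CFC.sqrt S) with hA
  set T : E p →L[ℝ] E p := Matrix.toEuclideanCLM (𝕜 := ℝ) S⁻¹ with hT
  have hAA : A * A = Matrix.toEuclideanCLM (𝕜 := ℝ) S := by
    rw [hA, ← map_mul, CFC.sqrt_mul_sqrt_self _ hS.posSemidef.nonneg]
  have hdet : IsUnit S.det := hS.det_pos.ne'.isUnit
  have hTS : T * (A * A) = 1 := by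
    rw [hAA, hT, ← map_mul, Matrix.nonsing_inv_mul _ hdet, map_one]
  have hST : A * A * T = 1 := by
    rw [hAA, hT, ← map_mul, Matrix.mul_nonsing_inv _ hdet, map_one]
  have hself : IsSelfAdjoint A := (CFC.sqrt_nonneg S).isSelfAdjoint.map _
  -- Inserting T A A = 1 on the left avoids proving that T commutes with the square root A. The
  -- identity makes the quadratic form of S⁻¹, pulled back along A, the squared norm.
  have hATA : A * T * A = 1 := by
    calc A * T * A = T * (A * A) * (A * T * A) := by rw [hTS, one_mul]
      _ = T * A * (A * A * T) * A := by simp only [mul_assoc]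
      _ = 1 := by rw [hST, mul_one, mul_assoc, hTS]
  have hq : ∀ z, ⟪A z, T (A z)⟫ = ‖z‖ ^ 2 := fun z => by
    rw [← hself.adjoint_eq, ContinuousLinearMap.adjoint_inner_left, hself.adjoint_eq,
      show A (T (A z)) = (A * T * A) z from rfl, hATA]
    simp
  have hdetA : LinearMap.det (A : E p →ₗ[ℝ] E p) ≠ 0 := by
    have h1 : ((A : E p →ₗ[ℝ] E p) * ((A * T : E p →L[ℝ] E p) : E p →ₗ[ℝ] E p)) = 1 := by
      ext1 x
      exact congrArg (fun B : E p →L[ℝ] E p => B x) (by rw [← mul_assoc, hST] : A * (A * T) = 1)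
    intro h0
    have := congrArg LinearMap.det h1
    rw [map_mul, h0, zero_mul, map_one] at this
    exact zero_ne_one this
  have hmap : volume.map A =
      ENNReal.ofReal |(LinearMap.det (A : E p →ₗ[ℝ] E p))⁻¹| • (volume : Measure (E p)) :=
    Measure.map_linearMap_addHaar_eq_smul_addHaar volume hdetA
  set k := ENNReal.ofReal |(LinearMap.det (A : E p →ₗ[ℝ] E p))⁻¹| with hk
  refine ⟨c * k, mul_ne_zero hc0 ?_, ENNReal.mul_ne_top hct ENNReal.ofReal_ne_top, ?_⟩
  · rw [hk, Ne, ENNReal.ofReal_eq_zero, not_le]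
    exact abs_pos.2 (inv_ne_zero hdetA)
  ext s hs
  set φ : E p → ℝ≥0∞ := s.indicator fun x => ENNReal.ofReal
    (Real.exp (-(1 / 2) * ⟪x - t, T (x - t)⟫)) with hφ
  have hφm : Measurable φ := Measurable.indicator (by fun_prop) hs
  have hmeas : Measurable fun x : E p => t + A x := by fun_prop
  rw [multivariateGaussian, Measure.map_apply hmeas hs, hc, Measure.smul_apply, Measure.smul_apply,
    withDensity_apply _ (hmeas hs), withDensity_apply _ hs, smul_eq_mul, smul_eq_mul, mul_assoc]
  congr 1
  rw [← lintegral_indicator (hmeas hs), ← lintegral_indicator hs]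
  calc _ = ∫⁻ z, φ (t + A z) := by
        refine lintegral_congr fun z => ?_
        by_cases hz : t + A z ∈ s
        · rw [hφ, Set.indicator_of_mem hz, Set.indicator_of_mem (by exact hz)]
          simp only [add_sub_cancel_left, hq]
        · rw [hφ, Set.indicator_of_notMem hz, Set.indicator_of_notMem (by exact hz)]
    _ = ∫⁻ y, φ (t + y) ∂(volume.map A) :=
        (lintegral_map (hφm.comp (measurable_const_add t)) A.continuous.measurable).symm
    _ = k * ∫⁻ y, φ (t + y) := by rw [hmap, lintegral_smul_measure, smul_eq_mul]
    _ = k * ∫⁻ y, φ y := by rw [lintegral_add_left_eq_self]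

/-! ### Quadratic forms of positive definite matrices -/

variable {p : ℕ}

theorem norm_sqrt_apply_sq {S : Matrix (Fin p) (Fin p) ℝ} (hS : S.PosSemidef) (z : E p) :
    ‖Matrix.toEuclideanCLM (𝕜 := ℝ) (CFC.sqrt S) z‖ ^ 2
      = ⟪z, Matrix.toEuclideanCLM (𝕜 := ℝ) S z⟫ := by
  have hself : IsSelfAdjoint (Matrix.toEuclideanCLM (𝕜 := ℝ) (CFC.sqrt S)) :=
    (CFC.sqrt_nonneg S).isSelfAdjoint.map _
  rw [← real_inner_self_eq_norm_sq]
  nth_rw 1 [← hself.adjoint_eq]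
  rw [ContinuousLinearMap.adjoint_inner_left]
  congr 1
  change (Matrix.toEuclideanCLM (𝕜 := ℝ) (CFC.sqrt S) *
    Matrix.toEuclideanCLM (𝕜 := ℝ) (CFC.sqrt S)) z = _
  rw [← map_mul, CFC.sqrt_mul_sqrt_self _ hS.nonneg]

/-- The quadratic form of a positive definite matrix is coercive and bounded. -/
theorem exists_quadratic_bounds {V : Matrix (Fin p) (Fin p) ℝ} (hV : V.PosDef) :
    ∃ l L : ℝ, 0 < l ∧ 0 < L ∧
      (∀ x : E p, l * ‖x‖ ^ 2 ≤ ⟪x, Matrix.toEuclideanCLM (𝕜 := ℝ) V x⟫) ∧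
      ∀ x y : E p, |⟪x, Matrix.toEuclideanCLM (𝕜 := ℝ) V y⟫| ≤ L * ‖x‖ * ‖y‖ := by
  set T : E p →L[ℝ] E p := Matrix.toEuclideanCLM (𝕜 := ℝ) V with hT
  set A : E p →L[ℝ] E p := Matrix.toEuclideanCLM (𝕜 := ℝ) (CFC.sqrt V) with hA
  set W : E p →L[ℝ] E p := Matrix.toEuclideanCLM (𝕜 := ℝ) V⁻¹ * A with hW
  have hWA : W * A = 1 := by
    rw [hW, hA, mul_assoc, ← map_mul, CFC.sqrt_mul_sqrt_self _ hV.posSemidef.nonneg, ← map_mul,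
      Matrix.nonsing_inv_mul _ hV.det_pos.ne'.isUnit, map_one]
  -- W is a left inverse of √V, so ‖x‖ ≤ ‖W‖ ‖√V x‖, which is coercivity. Adding 1 keeps both
  -- constants positive even when the operator norms vanish.
  refine ⟨((‖W‖ + 1) ^ 2)⁻¹, ‖T‖ + 1, by positivity, by positivity, fun x => ?_, fun x y => ?_⟩
  · rw [← norm_sqrt_apply_sq hV.posSemidef, ← hA, inv_mul_le_iff₀ (by positivity), ← mul_pow]
    refine pow_le_pow_left₀ (norm_nonneg _) ?_ 2
    calc ‖x‖ = ‖W (A x)‖ := by rw [show W (A x) = (W * A) x from rfl, hWA]; rfl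
      _ ≤ ‖W‖ * ‖A x‖ := W.le_opNorm _
      _ ≤ _ := by gcongr; linarith
  · calc |⟪x, T y⟫| ≤ ‖x‖ * ‖T y‖ := abs_real_inner_le_norm _ _
      _ ≤ ‖x‖ * ((‖T‖ + 1) * ‖y‖) := by
        gcongr
        exact (T.le_opNorm y).trans (by gcongr; linarith)
      _ = _ := by ring

theorem inner_toEuclideanCLM_comm {V : Matrix (Fin p) (Fin p) ℝ} (hV : V.IsHermitian)
    (x y : E p) : ⟪x, Matrix.toEuclideanCLM (𝕜 := ℝ) V y⟫
      = ⟪y, Matrix.toEuclideanCLM (𝕜 := ℝ) V x⟫ := by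
  have hself : IsSelfAdjoint (Matrix.toEuclideanCLM (𝕜 := ℝ) V) :=
    IsSelfAdjoint.map (show IsSelfAdjoint V from hV) _
  rw [real_inner_comm]
  nth_rw 1 [← hself.adjoint_eq]
  rw [ContinuousLinearMap.adjoint_inner_left]

theorem inner_toEuclideanCLM_add {V : Matrix (Fin p) (Fin p) ℝ} (hV : V.IsHermitian)
    (x y : E p) : ⟪x + y, Matrix.toEuclideanCLM (𝕜 := ℝ) V (x + y)⟫
      = ⟪x, Matrix.toEuclideanCLM (𝕜 := ℝ) V x⟫ + 2 * ⟪y, Matrix.toEuclideanCLM (𝕜 := ℝ) V x⟫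
        + ⟪y, Matrix.toEuclideanCLM (𝕜 := ℝ) V y⟫ := by
  rw [map_add, inner_add_left, inner_add_right, inner_add_right, inner_toEuclideanCLM_comm hV x y]
  ring

/-! ### Translation, localization and tightness of Gaussian measures -/

/-- The Gaussian measure with mean `t` and precision matrix `b V`. -/
theorem exists_gaussian_precision_eq {V : Matrix (Fin p) (Fin p) ℝ} (hV : V.PosDef) (t : E p)
    {b : ℝ} (hb : 0 < b) :
    ∃ c : ℝ≥0∞, c ≠ 0 ∧ c ≠ ∞ ∧ multivariateGaussian t (b⁻¹ • V⁻¹) =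
      c • volume.withDensity fun x : E p => ENNReal.ofReal
        (Real.exp (-(b / 2) * ⟪x - t, Matrix.toEuclideanCLM (𝕜 := ℝ) V (x - t)⟫)) := by
  obtain ⟨c, hc0, hct, hc⟩ :=
    exists_multivariateGaussian_eq_smul_withDensity t (hV.inv.smul (inv_pos.2 hb))
  refine ⟨c, hc0, hct, ?_⟩
  rw [hc]
  have : (b⁻¹ • V⁻¹)⁻¹ = b • V := by
    refine Matrix.inv_eq_left_inv ?_
    rw [Matrix.smul_mul, Matrix.mul_smul, smul_smul, mul_inv_cancel₀ hb.ne', one_smul,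
      Matrix.mul_nonsing_inv _ hV.det_pos.ne'.isUnit]
  simp_rw [this, map_smul, _root_.smul_apply, inner_smul_right, ← mul_assoc]
  rw [show -(1 / 2) * b = -(b / 2) by ring]

/-- A Gaussian measure loses at most a factor `exp (-κ)` under a translation that increases half of
its quadratic form by at most `κ`. -/
theorem le_gaussian_closedBall_add {V : Matrix (Fin p) (Fin p) ℝ} (hV : V.PosDef) (t : E p)
    {b : ℝ} (hb : 0 < b) (u v : E p) (r κ : ℝ)
    (h : ∀ x ∈ Metric.closedBall u r,
      b / 2 * (2 * ⟪v, Matrix.toEuclideanCLM (𝕜 := ℝ) V (x - t)⟫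
        + ⟪v, Matrix.toEuclideanCLM (𝕜 := ℝ) V v⟫) ≤ κ) :
    Real.exp (-κ) * (multivariateGaussian t (b⁻¹ • V⁻¹)).real (Metric.closedBall u r) ≤
      (multivariateGaussian t (b⁻¹ • V⁻¹)).real (Metric.closedBall (u + v) r) := by
  have hle : ENNReal.ofReal (Real.exp (-κ)) *
      multivariateGaussian t (b⁻¹ • V⁻¹) (Metric.closedBall u r) ≤
      multivariateGaussian t (b⁻¹ • V⁻¹) (Metric.closedBall (u + v) r) := by
    obtain ⟨c, -, -, hc⟩ := exists_gaussian_precision_eq hV t hb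
    rw [hc, Measure.smul_apply, Measure.smul_apply, smul_eq_mul, smul_eq_mul,
      withDensity_apply _ measurableSet_closedBall, withDensity_apply _ measurableSet_closedBall,
      mul_left_comm]
    gcongr
    rw [← lintegral_const_mul _ (by fun_prop), ← lintegral_indicator measurableSet_closedBall,
      ← lintegral_indicator measurableSet_closedBall]
    conv_rhs => rw [← lintegral_add_right_eq_self _ v]
    refine lintegral_mono fun x => ?_
    by_cases hx : x ∈ Metric.closedBall u r
    · have hx' : x + v ∈ Metric.closedBall (u + v) r := by simpa using hx
      rw [Set.indicator_of_mem hx, Set.indicator_of_mem hx', ← ENNReal.ofReal_mul (Real.exp_pos _).le,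
        ← Real.exp_add]
      refine ENNReal.ofReal_le_ofReal (Real.exp_le_exp.2 ?_)
      rw [add_sub_right_comm x v t, inner_toEuclideanCLM_add hV.isHermitian]
      linarith [h x hx]
    · rw [Set.indicator_of_notMem hx]
      exact zero_le
  have := ENNReal.toReal_mono (measure_ne_top _ _) hle
  rwa [ENNReal.toReal_mul, ENNReal.toReal_ofReal (Real.exp_pos _).le] at this

/-- If a probability measure puts mass at least `3/4` on a ball, and is nearly proportional to a
Gaussian measure on the ball with four times the radius, then the mean of the Gaussian measure is
close to the centre of the ball and its standard deviation is at most of the order of the radius. -/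
theorem exists_gaussian_localization [Nontrivial (E p)] {V : Matrix (Fin p) (Fin p) ℝ}
    (hV : V.PosDef) :
    ∃ K κ : ℝ, 0 < K ∧ 0 < κ ∧ ∀ (u t : E p) (r b m : ℝ) (μ : Measure (E p))
      [IsProbabilityMeasure μ], 0 < r → 0 < b →
      (∀ A, MeasurableSet A → A ⊆ Metric.closedBall u (4 * r) →
        m * (multivariateGaussian t (b⁻¹ • V⁻¹)).real A ≤ μ.real A ∧
        μ.real A ≤ 9 / 8 * (m * (multivariateGaussian t (b⁻¹ • V⁻¹)).real A)) →
      3 / 4 ≤ μ.real (Metric.closedBall u r) →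
      ‖t - u‖ ≤ K * r ∧ κ ≤ b * r ^ 2 := by
  obtain ⟨l, L, hl, hL, hlow, hupp⟩ := exists_quadratic_bounds hV
  -- For v of length 3r pointing from u to t, the form changes by at most 15 L r² - 6 l r ‖t - u‖,
  -- which is nonpositive once ‖t - u‖ ≥ K r.
  set K : ℝ := 5 * L / (2 * l) with hK
  have hKpos : 0 < K := by positivity
  refine ⟨K, 1 / (2 * L * (15 + 6 * K)), hKpos, by positivity, ?_⟩
  intro u t r b m μ _ hr hb hsand hmass
  set T : E p →L[ℝ] E p := Matrix.toEuclideanCLM (𝕜 := ℝ) V with hT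
  set ν := multivariateGaussian t (b⁻¹ • V⁻¹) with hν
  -- The translate by v is disjoint from the ball and stays within radius 4r. An increase of at most
  -- 1/4 costs a factor exp(-1/4) ≥ 3/4, so the translate would have μ-mass at least (3/4)(8/9)(3/4)
  -- = 1/2, too much next to 3/4.
  have key : ∀ v : E p, ‖v‖ = 3 * r →
      ¬ ∀ x ∈ Metric.closedBall u r, b / 2 * (2 * ⟪v, T (x - t)⟫ + ⟪v, T v⟫) ≤ 1 / 4 := by
    intro v hv hx
    have h1 := le_gaussian_closedBall_add hV t hb u v r (1 / 4) hx
    rw [← hν] at h1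
    have hsub1 : Metric.closedBall u r ⊆ Metric.closedBall u (4 * r) :=
      Metric.closedBall_subset_closedBall (by linarith)
    have hsub2 : Metric.closedBall (u + v) r ⊆ Metric.closedBall u (4 * r) :=
      Metric.closedBall_subset_closedBall' (by rw [dist_self_add_left, hv]; linarith)
    obtain ⟨-, h2⟩ := hsand _ measurableSet_closedBall hsub1
    obtain ⟨h3, -⟩ := hsand _ measurableSet_closedBall hsub2
    have hdisj : Disjoint (Metric.closedBall u r) (Metric.closedBall (u + v) r) :=
      Metric.closedBall_disjoint_closedBall (by rw [dist_self_add_right, hv]; linarith)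
    have h4 : μ.real (Metric.closedBall u r) + μ.real (Metric.closedBall (u + v) r) ≤ 1 := by
      rw [← measureReal_union hdisj measurableSet_closedBall]
      exact measureReal_le_one
    have h5 : (3 / 4 : ℝ) ≤ Real.exp (-(1 / 4)) := by
      have := Real.add_one_le_exp (-(1 / 4 : ℝ))
      linarith
    have hm : 0 ≤ m := by
      by_contra hm
      have : m * ν.real (Metric.closedBall u r) ≤ 0 :=
        mul_nonpos_of_nonpos_of_nonneg (not_le.1 hm).le measureReal_nonneg
      linarith
    have h6 : m * (3 / 4 * ν.real (Metric.closedBall u r)) ≤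
        m * ν.real (Metric.closedBall (u + v) r) :=
      mul_le_mul_of_nonneg_left ((mul_le_mul_of_nonneg_right h5 measureReal_nonneg).trans h1) hm
    linarith
  have hfirst : ‖t - u‖ ≤ K * r := by
    by_contra hlt
    push Not at hlt
    set d := ‖t - u‖ with hd
    have hdpos : 0 < d := lt_trans (by positivity) hlt
    refine key ((3 * r / d) • (t - u)) ?_ fun x hx => ?_
    · rw [norm_smul, Real.norm_of_nonneg (by positivity), ← hd]
      field_simp
    · set v : E p := (3 * r / d) • (t - u) with hv
      have hvn : ‖v‖ = 3 * r := by
        rw [hv, norm_smul, Real.norm_of_nonneg (by positivity), ← hd]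
        field_simp
      have e1 : ⟪v, T (x - t)⟫ = ⟪v, T (x - u)⟫ - 3 * r / d * ⟪t - u, T (t - u)⟫ := by
        rw [← sub_sub_sub_cancel_right x t u, map_sub, inner_sub_right]
        congr 1
        rw [hv, real_inner_smul_left]
      have e2 : ⟪v, T (x - u)⟫ ≤ L * (3 * r) * r := by
        refine (le_abs_self _).trans ((hupp _ _).trans ?_)
        rw [hvn]
        gcongr
        exact mem_closedBall_iff_norm.1 hx
      have e3 : ⟪v, T v⟫ ≤ L * (3 * r) * (3 * r) := by
        refine (le_abs_self _).trans ((hupp _ _).trans ?_)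
        rw [hvn]
      have e4 : 3 * r * (l * d) ≤ 3 * r / d * ⟪t - u, T (t - u)⟫ := by
        have := mul_le_mul_of_nonneg_left (hlow (t - u)) (by positivity : 0 ≤ 3 * r / d)
        refine le_trans (le_of_eq ?_) this
        rw [← hd]
        field_simp
      have e5 : 5 * L * r ≤ 2 * (l * d) := by
        rw [hK, div_mul_eq_mul_div, div_lt_iff₀ (by positivity)] at hlt
        linarith
      have e6 : 2 * ⟪v, T (x - t)⟫ + ⟪v, T v⟫ ≤ 0 := by
        rw [e1]
        nlinarith
      have := mul_nonpos_of_nonneg_of_nonpos (by positivity : 0 ≤ b / 2) e6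
      linarith
  refine ⟨hfirst, ?_⟩
  by_contra hlt
  push Not at hlt
  -- Any direction serves here: when b r² is small, the Gaussian density is nearly constant at scale
  -- r.
  obtain ⟨v, hv⟩ := exists_norm_eq (E p) (by positivity : 0 ≤ 3 * r)
  refine key v hv fun x hx => ?_
  have e2 : ⟪v, T (x - t)⟫ ≤ L * (3 * r) * ((1 + K) * r) := by
    refine (le_abs_self _).trans ((hupp _ _).trans ?_)
    rw [hv]
    gcongr
    rw [← sub_sub_sub_cancel_right x t u]
    refine (norm_sub_le _ _).trans ?_
    linarith [mem_closedBall_iff_norm.1 hx]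
  have e3 : ⟪v, T v⟫ ≤ L * (3 * r) * (3 * r) := by
    refine (le_abs_self _).trans ((hupp _ _).trans ?_)
    rw [hv]
  rw [lt_div_iff₀ (by positivity)] at hlt
  calc b / 2 * (2 * ⟪v, T (x - t)⟫ + ⟪v, T v⟫)
      ≤ b / 2 * (2 * (L * (3 * r) * ((1 + K) * r)) + L * (3 * r) * (3 * r)) := by gcongr
    _ = b * r ^ 2 * (2 * L * (15 + 6 * K)) / 4 := by ring
    _ ≤ 1 / 4 := by linarith

/-- Uniform tightness of Gaussian measures whose mean is close to `u`, with standard deviation of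
the order of `r`. -/
theorem exists_gaussian_closedBall_ge (V : Matrix (Fin p) (Fin p) ℝ) (hV : V.PosDef) {K κ ε : ℝ}
    (hκ : 0 < κ) (hε : 0 < ε) :
    ∃ ℓ₀ : ℝ, ∀ ℓ, ℓ₀ ≤ ℓ → ∀ (u t : E p) (r b : ℝ), 0 < r → 0 < b → ‖t - u‖ ≤ K * r →
      κ ≤ b * r ^ 2 →
      1 - ε ≤ (multivariateGaussian t (b⁻¹ • V⁻¹)).real (Metric.closedBall u (ℓ * r)) := by
  obtain ⟨R, hR⟩ : ∃ R : ℝ, 1 - ε ≤ (stdGaussian (E p)).real (Metric.closedBall 0 R) := by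
    have hlim : Tendsto (fun n : ℕ => (stdGaussian (E p)) (Metric.closedBall 0 (n : ℝ))) atTop
        (𝓝 ((stdGaussian (E p)) Set.univ)) := by
      rw [← Metric.iUnion_closedBall_nat (0 : E p)]
      exact tendsto_measure_iUnion_atTop fun i j hij =>
        Metric.closedBall_subset_closedBall (by exact_mod_cast hij)
    have hlim' := (ENNReal.tendsto_toReal (measure_ne_top _ _)).comp hlim
    rw [measure_univ, ENNReal.toReal_one] at hlim'
    obtain ⟨n, hn⟩ := (hlim'.eventually (lt_mem_nhds (by linarith : 1 - ε < 1))).exists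
    exact ⟨n, hn.le⟩
  obtain ⟨-, L, -, hL, -, hupp⟩ := exists_quadratic_bounds hV.inv
  -- K r covers the displacement of the mean. Since b⁻¹ ≤ r²/κ, the image of the ball of radius R
  -- under the square root of the covariance has radius at most √(L/κ) |R| r.
  refine ⟨K + √(L / κ) * |R|, fun ℓ hℓ u t r b hr hb ht hbr => hR.trans ?_⟩
  have hmeas : Measurable fun x : E p => t + Matrix.toEuclideanCLM (𝕜 := ℝ)
    (CFC.sqrt (b⁻¹ • V⁻¹)) x := by fun_prop
  rw [multivariateGaussian, map_measureReal_apply hmeas measurableSet_closedBall]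
  refine measureReal_mono fun z hz => ?_
  rw [Set.mem_preimage, mem_closedBall_iff_norm]
  rw [mem_closedBall_zero_iff] at hz
  have hA : ‖Matrix.toEuclideanCLM (𝕜 := ℝ) (CFC.sqrt (b⁻¹ • V⁻¹)) z‖ ≤ √(L / κ) * |R| * r := by
    refine abs_le_of_sq_le_sq' ?_ (by positivity) |>.2
    rw [norm_sqrt_apply_sq (hV.inv.smul (inv_pos.2 hb)).posSemidef, map_smul,
      _root_.smul_apply, inner_smul_right, mul_pow, mul_pow,
      Real.sq_sqrt (by positivity), sq_abs]
    have h1 : ⟪z, Matrix.toEuclideanCLM (𝕜 := ℝ) V⁻¹ z⟫ ≤ L * R ^ 2 := by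
      refine (le_abs_self _).trans ((hupp _ _).trans ?_)
      rw [mul_assoc, ← sq]
      gcongr
    have h2 : b⁻¹ ≤ r ^ 2 / κ := by
      rw [inv_le_iff_one_le_mul₀ hb, div_mul_eq_mul_div, one_le_div hκ]
      linarith
    calc b⁻¹ * ⟪z, Matrix.toEuclideanCLM (𝕜 := ℝ) V⁻¹ z⟫ ≤ b⁻¹ * (L * R ^ 2) := by gcongr
      _ ≤ r ^ 2 / κ * (L * R ^ 2) := by gcongr
      _ = _ := by ring
  calc _ = ‖(t - u) + Matrix.toEuclideanCLM (𝕜 := ℝ) (CFC.sqrt (b⁻¹ • V⁻¹)) z‖ := by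
        congr 1; abel
    _ ≤ K * r + √(L / κ) * |R| * r := (norm_add_le _ _).trans (add_le_add ht hA)
    _ = (K + √(L / κ) * |R|) * r := by ring
    _ ≤ ℓ * r := by gcongr

/-! ### From near proportionality to total variation -/

/-- Two probability measures that are nearly proportional on a set which carries nearly all of
their mass are close in total variation. -/
theorem tvDist_le_of_nearly_proportional {S : Type*} [MeasurableSpace S] (μ ν : Measure S)
    [IsProbabilityMeasure μ] [IsProbabilityMeasure ν] {B : Set S} (hB : MeasurableSet B) {m ε : ℝ}
    (hε : 0 < ε) (hε2 : ε ≤ 1 / 2)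
    (h : ∀ A, MeasurableSet A → A ⊆ B →
      m * ν.real A ≤ μ.real A ∧ μ.real A ≤ (1 + ε) * (m * ν.real A))
    (hμ : 1 - ε ≤ μ.real B) (hν : 1 - ε ≤ ν.real B) : tvDist μ ν ≤ 5 * ε := by
  have hm : 0 ≤ m := by
    by_contra hm
    have h1 : m * ν.real B < 0 := mul_neg_of_neg_of_pos (not_le.1 hm) (by linarith)
    have h2 := (h B hB subset_rfl).2
    nlinarith
  have hm1 : m * (1 - ε) ≤ 1 :=
    (mul_le_mul_of_nonneg_left hν hm).trans ((h B hB subset_rfl).1.trans measureReal_le_one)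
  -- A one-sided bound suffices, since complements exchange the two signs. For ε ≤ 1/2 one has (1 +
  -- ε)/(1 - ε) ≤ 1 + 4ε, and the mass outside B adds the fifth ε.
  have key : ∀ A, MeasurableSet A → μ.real A - ν.real A ≤ 5 * ε := by
    intro A hA
    have h1 : μ.real A ≤ μ.real (A ∩ B) + μ.real Bᶜ := by
      refine (measureReal_mono (s₂ := (A ∩ B) ∪ Bᶜ) fun x hx => ?_).trans (measureReal_union_le _ _)
      by_cases hxB : x ∈ B
      · exact Or.inl ⟨hx, hxB⟩
      · exact Or.inr hxB
    rw [probReal_compl_eq_one_sub hB] at h1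
    have h2 := (h (A ∩ B) (hA.inter hB) Set.inter_subset_right).2
    have h3 : ν.real (A ∩ B) ≤ ν.real A := measureReal_mono Set.inter_subset_left
    have h4 : ν.real A ≤ 1 := measureReal_le_one
    have h5 : 0 ≤ ν.real (A ∩ B) := measureReal_nonneg
    have h6 : (1 + ε) * m ≤ 1 + 4 * ε := by nlinarith
    have h7 : (1 + ε) * m * ν.real (A ∩ B) ≤ (1 + 4 * ε) * ν.real (A ∩ B) := by gcongr
    nlinarith
  refine ciSup_le fun A => abs_le.2 ⟨?_, key A A.2⟩
  have := key _ A.2.compl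
  rw [probReal_compl_eq_one_sub A.2, probReal_compl_eq_one_sub A.2] at this
  linarith

/-- A probability measure which puts nearly all of its mass on a ball, and is nearly proportional to
a Gaussian measure on a large multiple of it, is close to the Gaussian measure in total variation;
the multiple does not depend on the mean and the scale of the Gaussian measure. -/
theorem exists_tvDist_gaussian_le {V : Matrix (Fin p) (Fin p) ℝ} (hV : V.PosDef) {ε : ℝ}
    (hε : 0 < ε) (hε8 : ε ≤ 1 / 8) :
    ∃ ℓ : ℝ, 0 < ℓ ∧ ∀ (u t : E p) (r b m : ℝ) (μ : Measure (E p)) [IsProbabilityMeasure μ],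
      0 < r → 0 < b →
      (∀ A, MeasurableSet A → A ⊆ Metric.closedBall u (ℓ * r) →
        m * (multivariateGaussian t (b⁻¹ • V⁻¹)).real A ≤ μ.real A ∧
        μ.real A ≤ (1 + ε) * (m * (multivariateGaussian t (b⁻¹ • V⁻¹)).real A)) →
      1 - ε ≤ μ.real (Metric.closedBall u r) →
      tvDist μ (multivariateGaussian t (b⁻¹ • V⁻¹)) ≤ 5 * ε := by
  cases subsingleton_or_nontrivial (E p) with
  | inl hsub =>
    -- In dimension zero no vector of length 3r exists for the translation argument, but every ball
    -- is the whole space.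
    refine ⟨1, one_pos, fun u t r b m μ _ hr hb hs hmass => ?_⟩
    rw [one_mul] at hs
    have huniv : Metric.closedBall u r = Set.univ :=
      Set.eq_univ_of_forall fun x => by
        rw [Subsingleton.elim x u]; exact Metric.mem_closedBall_self hr.le
    refine tvDist_le_of_nearly_proportional μ _ measurableSet_closedBall hε (by linarith) hs hmass ?_
    rw [huniv, probReal_univ]
    linarith
  | inr hnt =>
    obtain ⟨K, κ, hK, hκ, hloc⟩ := exists_gaussian_localization hV
    obtain ⟨ℓ₀, hℓ₀⟩ := exists_gaussian_closedBall_ge V hV (K := K) hκ hε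
    refine ⟨max 4 ℓ₀, by positivity, fun u t r b m μ _ hr hb hs hmass => ?_⟩
    have h4 : 4 * r ≤ max 4 ℓ₀ * r := by gcongr; exact le_max_left _ _
    have h1 : r ≤ max 4 ℓ₀ * r := by linarith
    obtain ⟨hd, hs2⟩ := hloc u t r b m μ hr hb (fun A hA hsub => by
      obtain ⟨h2, h3⟩ := hs A hA (hsub.trans (Metric.closedBall_subset_closedBall h4))
      refine ⟨h2, h3.trans ?_⟩
      -- The sign of m is not assumed; nonnegativity of this product is what allows 1 + ε to be
      -- enlarged to 9/8.
      have h0 : 0 ≤ m * (multivariateGaussian t (b⁻¹ • V⁻¹)).real A := by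
        have := measureReal_nonneg (μ := μ) (s := A)
        nlinarith
      nlinarith) (by linarith)
    exact tvDist_le_of_nearly_proportional μ _ measurableSet_closedBall hε (by linarith) hs
      (hmass.trans (measureReal_mono (Metric.closedBall_subset_closedBall h1)))
      (hℓ₀ _ (le_max_right _ _) u t r b hr hb hd hs2)

/-! ### Measurability and normalisation of the posterior -/

variable {𝒳 : Type*}

theorem measurable_weightedLoss [MeasurableSpace 𝒳] {ρ : 𝒳 → E p → ℝ}
    (hρ : Measurable fun z : 𝒳 × E p => ρ z.1 z.2) (α : ℕ → ℝ) (n : ℕ) :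
    Measurable fun z : (ℕ → 𝒳) × E p => weightedLoss ρ α n z.1 z.2 := by
  unfold weightedLoss
  refine Finset.measurable_sum _ fun i _ => Measurable.const_mul ?_ _
  have h : Measurable fun z : (ℕ → 𝒳) × E p => (z.1 i, z.2) := by fun_prop
  exact hρ.comp h

theorem measurable_posteriorWeight [MeasurableSpace 𝒳] {ρ : 𝒳 → E p → ℝ}
    (hρ : Measurable fun z : 𝒳 × E p => ρ z.1 z.2) {π : E p → ℝ} (hπ : Measurable π) (α : ℕ → ℝ)
    (n : ℕ) : Measurable fun z : (ℕ → 𝒳) × E p =>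
      ENNReal.ofReal (Real.exp (-weightedLoss ρ α n z.1 z.2) * π z.2) :=
  ((measurable_weightedLoss hρ α n).neg.exp.mul (hπ.comp measurable_snd)).ennreal_ofReal

theorem measurable_posteriorWeight_right [MeasurableSpace 𝒳] {ρ : 𝒳 → E p → ℝ}
    (hρ : Measurable fun z : 𝒳 × E p => ρ z.1 z.2) {π : E p → ℝ} (hπ : Measurable π) (α : ℕ → ℝ)
    (n : ℕ) (x : ℕ → 𝒳) : Measurable fun θ : E p =>
      ENNReal.ofReal (Real.exp (-weightedLoss ρ α n x θ) * π θ) := by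
  have h : ∀ y, Measurable (ρ y) := fun y => Measurable.of_uncurry_left (f := ρ) hρ
  have hL : Measurable fun θ => weightedLoss ρ α n x θ :=
    Finset.measurable_sum _ fun i _ => (h (x i)).const_mul _
  exact (hL.neg.exp.mul hπ).ennreal_ofReal

theorem posterior_apply (Θ : Set (E p)) (ρ : 𝒳 → E p → ℝ) (π : E p → ℝ) (α : ℕ → ℝ) (n : ℕ)
    (x : ℕ → 𝒳) {A : Set (E p)} (hA : MeasurableSet A) :
    posterior Θ ρ π α n x A = (normalizer Θ ρ π α n x)⁻¹ *
      ∫⁻ θ in A ∩ Θ, ENNReal.ofReal (Real.exp (-weightedLoss ρ α n x θ) * π θ) := by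
  rw [posterior, Measure.smul_apply, smul_eq_mul, unnormalizedPosterior, withDensity_apply _ hA,
    Measure.restrict_restrict hA]

/-- Joint measurability of the loss and Tonelli give measurability in the data, which Markov's
inequality for the posterior mass requires. -/
theorem measurable_posterior_apply [MeasurableSpace 𝒳] (Θ : Set (E p)) {ρ : 𝒳 → E p → ℝ}
    (hρ : Measurable fun z : 𝒳 × E p => ρ z.1 z.2) {π : E p → ℝ} (hπ : Measurable π) (α : ℕ → ℝ)
    (n : ℕ) {A : Set (E p)} (hA : MeasurableSet A) :
    Measurable fun x : ℕ → 𝒳 => posterior Θ ρ π α n x A := by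
  simp_rw [posterior_apply Θ ρ π α n _ hA]
  exact (measurable_posteriorWeight hρ hπ α n).lintegral_prod_right'.inv.mul
    (measurable_posteriorWeight hρ hπ α n).lintegral_prod_right'

theorem isProbabilityMeasure_posterior {Θ : Set (E p)} {ρ : 𝒳 → E p → ℝ} {π : E p → ℝ}
    {α : ℕ → ℝ} {n : ℕ} {x : ℕ → 𝒳} (h0 : normalizer Θ ρ π α n x ≠ 0)
    (ht : normalizer Θ ρ π α n x ≠ ∞) : IsProbabilityMeasure (posterior Θ ρ π α n x) := by
  constructor
  rw [posterior_apply _ _ _ _ _ _ MeasurableSet.univ, Set.univ_inter]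
  exact ENNReal.inv_mul_cancel h0 ht

theorem normalizer_ne_zero [MeasurableSpace 𝒳] {Θ : Set (E p)} {ρ : 𝒳 → E p → ℝ}
    (hρ : Measurable fun z : 𝒳 × E p => ρ z.1 z.2) {π : E p → ℝ} (hπ : Measurable π) (α : ℕ → ℝ)
    (n : ℕ) (x : ℕ → 𝒳) {u : E p} {d : ℝ} (hd : 0 < d) (hΘ : Metric.closedBall u d ⊆ Θ)
    (hpos : ∀ θ ∈ Metric.closedBall u d, 0 < π θ) : normalizer Θ ρ π α n x ≠ 0 := by
  have hm : Measurable fun θ => ENNReal.ofReal (Real.exp (-weightedLoss ρ α n x θ) * π θ) :=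
    measurable_posteriorWeight_right hρ hπ α n x
  refine ((setLIntegral_pos_iff hm).2 ?_).ne'
  refine (Metric.measure_closedBall_pos volume u hd).trans_le (measure_mono fun θ hθ => ⟨?_, hΘ hθ⟩)
  rw [Function.mem_support, ← pos_iff_ne_zero, ENNReal.ofReal_pos]
  exact mul_pos (Real.exp_pos _) (hpos θ hθ)

/-! ### Local Gaussian shape of the posterior -/

/-- The quadratic expansion of the weighted loss, with the square completed. -/
theorem neg_weightedLoss_eq (ρ : 𝒳 → E p → ℝ) (α : ℕ → ℝ) {V : Matrix (Fin p) (Fin p) ℝ}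
    (hV : V.IsHermitian) {n : ℕ} (hn : 0 < n) (x : ℕ → 𝒳) (u t θ : E p) :
    -weightedLoss ρ α n x θ = -weightedLoss ρ α n x u
      + avgWeight α n * n / 2 * ⟪t - u, Matrix.toEuclideanCLM (𝕜 := ℝ) V (t - u)⟫
      + lanRemainder ρ α u V n x t (√(n : ℝ) • (θ - u))
      - avgWeight α n * n / 2 * ⟪θ - t, Matrix.toEuclideanCLM (𝕜 := ℝ) V (θ - t)⟫ := by
  have hs : 0 < √(n : ℝ) := Real.sqrt_pos.2 (by exact_mod_cast hn)
  have hss : √(n : ℝ) * √(n : ℝ) = n := Real.mul_self_sqrt (Nat.cast_nonneg n)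
  have hθ : u + (√(n : ℝ))⁻¹ • (√(n : ℝ) • (θ - u)) = θ := by
    rw [smul_smul, inv_mul_cancel₀ hs.ne', one_smul, add_sub_cancel]
  have hsum : ∑ i ∈ Finset.range n, α i * (ρ (x i) u - ρ (x i) θ) =
      weightedLoss ρ α n x u - weightedLoss ρ α n x θ := by
    simp only [weightedLoss, mul_sub, Finset.sum_sub_distrib]
  have hq : ⟪θ - t, Matrix.toEuclideanCLM (𝕜 := ℝ) V (θ - t)⟫ =
      ⟪θ - u, Matrix.toEuclideanCLM (𝕜 := ℝ) V (θ - u)⟫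
      - 2 * ⟪θ - u, Matrix.toEuclideanCLM (𝕜 := ℝ) V (t - u)⟫
      + ⟪t - u, Matrix.toEuclideanCLM (𝕜 := ℝ) V (t - u)⟫ := by
    rw [← sub_sub_sub_cancel_right θ t u, map_sub, inner_sub_left, inner_sub_right, inner_sub_right,
      inner_toEuclideanCLM_comm hV (t - u) (θ - u)]
    ring
  rw [lanRemainder, hθ, hsum, hq, ← Matrix.inner_toEuclideanCLM, ← Matrix.inner_toEuclideanCLM,
    map_smul, map_smul, real_inner_smul_left, real_inner_smul_left, inner_smul_right,
    inner_smul_right, ← mul_assoc (√(n : ℝ)), ← mul_assoc (√(n : ℝ)), hss]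
  ring

/-- Near `u`, the posterior weight is nearly proportional to a Gaussian density. -/
theorem posteriorWeight_bounds {ρ : 𝒳 → E p → ℝ} {π : E p → ℝ}
    {α : ℕ → ℝ} {V : Matrix (Fin p) (Fin p) ℝ} (hV : V.IsHermitian) {n : ℕ} (hn : 0 < n)
    {x : ℕ → 𝒳} {u t : E p} {R d η : ℝ} (hd : √(n : ℝ) * d ≤ R) (hu : 0 < π u)
    (hπu : ∀ θ ∈ Metric.closedBall u d,
      Real.exp (-η) * π u ≤ π θ ∧ π θ ≤ Real.exp η * π u)
    (hlan : ∀ h ∈ Metric.closedBall (0 : E p) R, |lanRemainder ρ α u V n x t h| ≤ η)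
    {D : ℝ} (hD : D = π u * Real.exp (-weightedLoss ρ α n x u
      + avgWeight α n * n / 2 * ⟪t - u, Matrix.toEuclideanCLM (𝕜 := ℝ) V (t - u)⟫))
    {g : E p → ℝ} (hg : g = fun θ => Real.exp
      (-(avgWeight α n * n / 2) * ⟪θ - t, Matrix.toEuclideanCLM (𝕜 := ℝ) V (θ - t)⟫)) :
    ∀ θ ∈ Metric.closedBall u d,
      D * Real.exp (-(2 * η)) * g θ ≤ Real.exp (-weightedLoss ρ α n x θ) * π θ ∧
      Real.exp (-weightedLoss ρ α n x θ) * π θ ≤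
        Real.exp (4 * η) * (D * Real.exp (-(2 * η)) * g θ) := by
  intro θ hθ
  obtain ⟨h1, h2⟩ := hπu θ hθ
  have hh : √(n : ℝ) • (θ - u) ∈ Metric.closedBall (0 : E p) R := by
    rw [mem_closedBall_zero_iff, norm_smul, Real.norm_of_nonneg (Real.sqrt_nonneg _)]
    refine le_trans ?_ hd
    gcongr
    exact mem_closedBall_iff_norm.1 hθ
  obtain ⟨h3, h4⟩ := abs_le.1 (hlan _ hh)
  have hexp : Real.exp (-weightedLoss ρ α n x θ) * π θ =
      (Real.exp (lanRemainder ρ α u V n x t (√(n : ℝ) • (θ - u))) * π θ) *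
        (Real.exp (-weightedLoss ρ α n x u
          + avgWeight α n * n / 2 * ⟪t - u, Matrix.toEuclideanCLM (𝕜 := ℝ) V (t - u)⟫) * g θ) := by
    rw [neg_weightedLoss_eq ρ α hV hn x u t θ, hg]
    simp only [Real.exp_add, Real.exp_sub, neg_mul, Real.exp_neg]
    ring
  have hgpos : 0 < g θ := by rw [hg]; exact Real.exp_pos _
  -- The prior ratio and the M-LAN remainder each contribute a factor between exp(-η) and exp(η).
  have e1 : Real.exp (-(2 * η)) * π u ≤
      Real.exp (lanRemainder ρ α u V n x t (√(n : ℝ) • (θ - u))) * π θ := by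
    calc Real.exp (-(2 * η)) * π u = Real.exp (-η) * (Real.exp (-η) * π u) := by
          rw [← mul_assoc, ← Real.exp_add]; ring_nf
      _ ≤ _ := by gcongr
  have e2 : Real.exp (lanRemainder ρ α u V n x t (√(n : ℝ) • (θ - u))) * π θ ≤
      Real.exp (2 * η) * π u := by
    calc _ ≤ Real.exp η * (Real.exp η * π u) := by
          have : 0 < π θ := lt_of_lt_of_le (by positivity) h1
          gcongr
      _ = _ := by rw [← mul_assoc, ← Real.exp_add]; ring_nf
  rw [hexp]
  constructor
  · refine le_trans (le_of_eq ?_) (mul_le_mul_of_nonneg_right e1 (by positivity))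
    rw [hD]; ring
  · refine (mul_le_mul_of_nonneg_right e2 (by positivity)).trans (le_of_eq ?_)
    have : Real.exp (2 * η) = Real.exp (4 * η) * Real.exp (-(2 * η)) := by
      rw [← Real.exp_add]; ring_nf
    rw [hD, this]; ring

/-- Near `u`, the posterior is nearly proportional to the Gaussian measure. -/
theorem exists_posterior_nearly_proportional [MeasurableSpace 𝒳] {Θ : Set (E p)}
    {ρ : 𝒳 → E p → ℝ} {π : E p → ℝ} {α : ℕ → ℝ} {V : Matrix (Fin p) (Fin p) ℝ} (hV : V.PosDef) {n : ℕ} (hn : 0 < n)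
    (ha : 0 < avgWeight α n) {x : ℕ → 𝒳} {u t : E p} {R d η : ℝ}
    (hρ : Measurable fun z : 𝒳 × E p => ρ z.1 z.2) (hπ : Measurable π)
    (hd : √(n : ℝ) * d ≤ R) (hΘ : Metric.closedBall u d ⊆ Θ) (hu : 0 < π u)
    (hπu : ∀ θ ∈ Metric.closedBall u d,
      Real.exp (-η) * π u ≤ π θ ∧ π θ ≤ Real.exp η * π u)
    (hlan : ∀ h ∈ Metric.closedBall (0 : E p) R, |lanRemainder ρ α u V n x t h| ≤ η)
    (h0 : normalizer Θ ρ π α n x ≠ 0) (ht : normalizer Θ ρ π α n x ≠ ∞) :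
    ∃ m : ℝ, ∀ A, MeasurableSet A → A ⊆ Metric.closedBall u d →
      m * (multivariateGaussian t ((avgWeight α n * n)⁻¹ • V⁻¹)).real A
        ≤ (posterior Θ ρ π α n x).real A ∧
      (posterior Θ ρ π α n x).real A
        ≤ Real.exp (4 * η) * (m * (multivariateGaussian t ((avgWeight α n * n)⁻¹ • V⁻¹)).real A) := by
  set b := avgWeight α n * n with hb
  have hbpos : 0 < b := mul_pos ha (by exact_mod_cast hn)
  obtain ⟨c, hc0, hct, hc⟩ := exists_gaussian_precision_eq hV t hbpos
  set g : E p → ℝ := fun θ =>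
    Real.exp (-(b / 2) * ⟪θ - t, Matrix.toEuclideanCLM (𝕜 := ℝ) V (θ - t)⟫) with hg
  have hgm : Measurable fun θ => ENNReal.ofReal (g θ) := by fun_prop
  have hm : Measurable fun θ => ENNReal.ofReal (Real.exp (-weightedLoss ρ α n x θ) * π θ) :=
    measurable_posteriorWeight_right hρ hπ α n x
  set D : ℝ := π u * Real.exp (-weightedLoss ρ α n x u
    + b / 2 * ⟪t - u, Matrix.toEuclideanCLM (𝕜 := ℝ) V (t - u)⟫) with hD
  have hDpos : 0 < D := mul_pos hu (Real.exp_pos _)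
  have hpt := posteriorWeight_bounds hV.isHermitian hn hd hu hπu hlan hD hg
  set Z := normalizer Θ ρ π α n x with hZ
  have hprob := isProbabilityMeasure_posterior h0 ht
  -- Absorbing the lower error into the constant leaves the whole error exp(4η) on the upper side.
  set D' : ℝ := D * Real.exp (-(2 * η)) with hD'
  have hD'pos : 0 < D' := by positivity
  set M : ℝ≥0∞ := Z⁻¹ * (ENNReal.ofReal D' * c⁻¹) with hM
  refine ⟨M.toReal, fun A hA hAB => ?_⟩
  have hν : ∫⁻ θ in A, ENNReal.ofReal (g θ) =
      c⁻¹ * multivariateGaussian t (b⁻¹ • V⁻¹) A := by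
    rw [hc, Measure.smul_apply, smul_eq_mul, withDensity_apply _ hA, ← mul_assoc,
      ENNReal.inv_mul_cancel hc0 hct, one_mul]
  have hpost : posterior Θ ρ π α n x A = Z⁻¹ *
      ∫⁻ θ in A, ENNReal.ofReal (Real.exp (-weightedLoss ρ α n x θ) * π θ) := by
    rw [posterior_apply _ _ _ _ _ _ hA, Set.inter_eq_left.2 (hAB.trans hΘ)]
  have hlow : M * multivariateGaussian t (b⁻¹ • V⁻¹) A ≤ posterior Θ ρ π α n x A := by
    rw [hpost, hM, mul_assoc, mul_assoc, ← hν, ← lintegral_const_mul _ hgm]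
    gcongr Z⁻¹ * ?_
    refine setLIntegral_mono hm fun θ hθ => ?_
    rw [← ENNReal.ofReal_mul hD'pos.le]
    exact ENNReal.ofReal_le_ofReal (hpt θ (hAB hθ)).1
  have hupp : posterior Θ ρ π α n x A ≤
      ENNReal.ofReal (Real.exp (4 * η)) * (M * multivariateGaussian t (b⁻¹ • V⁻¹) A) := by
    rw [hpost, hM, mul_assoc, mul_assoc, ← hν, ← lintegral_const_mul _ hgm, mul_left_comm,
      ← lintegral_const_mul _ (hgm.const_mul _)]
    gcongr Z⁻¹ * ?_
    refine setLIntegral_mono ((hgm.const_mul _).const_mul _) fun θ hθ => ?_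
    rw [← ENNReal.ofReal_mul hD'pos.le, ← ENNReal.ofReal_mul (Real.exp_pos _).le]
    exact ENNReal.ofReal_le_ofReal (hpt θ (hAB hθ)).2
  have hMt : M ≠ ∞ := ENNReal.mul_ne_top (ENNReal.inv_ne_top.2 h0)
    (ENNReal.mul_ne_top ENNReal.ofReal_ne_top (ENNReal.inv_ne_top.2 hc0))
  constructor
  · have := ENNReal.toReal_mono (measure_ne_top _ _) hlow
    rwa [ENNReal.toReal_mul] at this
  · have := ENNReal.toReal_mono (ENNReal.mul_ne_top ENNReal.ofReal_ne_top
      (ENNReal.mul_ne_top hMt (measure_ne_top _ _))) hupp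
    rwa [ENNReal.toReal_mul, ENNReal.toReal_mul, ENNReal.toReal_ofReal (Real.exp_pos _).le] at this

/-! ### A fixed radius and a fixed neighbourhood -/

/-- If `F n (r n) → 0` for all sequences `r n → ∞`, then `F n r` is eventually small for some
fixed `r`. -/
theorem exists_eventually_le_of_forall_tendsto {F : ℕ → ℝ → ℝ≥0∞}
    (hF : ∀ r : ℕ → ℝ, Tendsto r atTop atTop → Tendsto (fun n => F n (r n)) atTop (𝓝 0))
    {δ : ℝ≥0∞} (hδ : 0 < δ) : ∃ r : ℝ, 0 < r ∧ ∀ᶠ n in atTop, F n r ≤ δ := by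
  by_contra hcon
  push Not at hcon
  obtain ⟨φ, hφ, hφF⟩ := extraction_forall_of_frequently
    (P := fun k n => δ < F n ((k : ℝ) + 1)) fun k => by
      simpa using hcon ((k : ℝ) + 1) (by positivity)
  -- A slowly growing left inverse of φ: the sequence s n + 1 tends to infinity and passes through
  -- the bad radius k + 1 at time φ k. The search bound n loses nothing because k ≤ φ k, and the
  -- default value 0 for small n is harmless.
  set s : ℕ → ℕ := fun n => Nat.findGreatest (fun k => φ k ≤ n) n with hs
  have hsφ : ∀ k, s (φ k) = k := fun k => by
    refine le_antisymm ?_ (Nat.le_findGreatest (hφ.id_le k) le_rfl)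
    have := Nat.findGreatest_spec (P := fun j => φ j ≤ φ k) (hφ.id_le k) le_rfl
    exact hφ.le_iff_le.1 this
  have hst : Tendsto s atTop atTop := by
    refine tendsto_atTop.2 fun k => ?_
    filter_upwards [eventually_ge_atTop (φ k)] with n hn
    exact Nat.le_findGreatest ((hφ.id_le k).trans hn) hn
  have h1 := (hF (fun n => (s n : ℝ) + 1) (tendsto_atTop_add_const_right _ _
    (tendsto_natCast_atTop_atTop.comp hst))).comp hφ.tendsto_atTop
  obtain ⟨k, hk⟩ := (h1.eventually (gt_mem_nhds hδ)).exists
  simp only [Function.comp_apply, hsφ] at hk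
  exact lt_asymm hk (hφF k)

/-- Continuity is put in multiplicative form so that the prior error combines with the exponentiated
M-LAN remainder. -/
theorem exists_closedBall_prior_bounds {Θ : Set (E p)} {u : E p} (hu : u ∈ interior Θ)
    {π : E p → ℝ} (hπ : ∃ U ∈ 𝓝 u, ContinuousOn π U ∧ ∀ θ ∈ U, 0 < π θ) {η : ℝ} (hη : 0 < η) :
    0 < π u ∧ ∃ d, 0 < d ∧ Metric.closedBall u d ⊆ Θ ∧ ∀ θ ∈ Metric.closedBall u d,
      Real.exp (-η) * π u ≤ π θ ∧ π θ ≤ Real.exp η * π u := by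
  obtain ⟨U, hU, hcont, hpos⟩ := hπ
  have hπu : 0 < π u := hpos u (mem_of_mem_nhds hU)
  have hca : Tendsto π (𝓝 u) (𝓝 (π u)) := hcont.continuousAt hU
  have h1 : Real.exp (-η) * π u < π u :=
    mul_lt_of_lt_one_left hπu (by simpa using hη)
  have h2 : π u < Real.exp η * π u := lt_mul_of_one_lt_left hπu (Real.one_lt_exp_iff.2 hη)
  have hev : ∀ᶠ θ in 𝓝 u, θ ∈ Θ ∧ Real.exp (-η) * π u ≤ π θ ∧ π θ ≤ Real.exp η * π u := by
    filter_upwards [mem_interior_iff_mem_nhds.1 hu, hca.eventually (lt_mem_nhds h1),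
      hca.eventually (gt_mem_nhds h2)] with θ a b c
    exact ⟨a, b.le, c.le⟩
  obtain ⟨d, hd, hsub⟩ := Metric.nhds_basis_closedBall.mem_iff.1 hev
  exact ⟨hπu, d, hd, fun θ hθ => (hsub hθ).1, fun θ hθ => (hsub hθ).2⟩

theorem tvDist_nonneg {S : Type*} [MeasurableSpace S] (μ ν : Measure S) : 0 ≤ tvDist μ ν :=
  Real.iSup_nonneg fun _ => abs_nonneg _

theorem avgWeight_pos {α : ℕ → ℝ} (hα : ∀ i, 0 < α i) {n : ℕ} (hn : 0 < n) :
    0 < avgWeight α n :=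
  div_pos (Finset.sum_pos (fun i _ => hα i) (Finset.nonempty_range_iff.2 hn.ne'))
    (by exact_mod_cast hn)

end MPosterior

/-! ### Convergence in probability -/

theorem theorem1 {Ω : Type*} [MeasurableSpace Ω] (P : Measure Ω) [IsProbabilityMeasure P]
    {𝒳 : Type*} [MeasurableSpace 𝒳] {p : ℕ} (M : MPosterior.ParametricModel 𝒳 p)
    -- the true parameter, and the i.i.d. sample drawn from the model at it
    (θstar : MPosterior.E p) (hθstar : θstar ∈ interior M.paramSpace)
    (X : ℕ → Ω → 𝒳) (hX_indep : iIndepFun X P) (hX_law : ∀ i, HasLaw (X i) (M.dist θstar) P)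
    -- the weights
    (α : ℕ → ℝ) (hα : MPosterior.AdmissibleWeights α)
    -- the loss and its score function
    (ρ : 𝒳 → MPosterior.E p → ℝ) (hρ : Measurable fun z : 𝒳 × MPosterior.E p => ρ z.1 z.2)
    (ψ : 𝒳 → MPosterior.E p → MPosterior.E p) (hψ : MPosterior.IsScore M.paramSpace ρ ψ)
    -- the prior density
    (π : MPosterior.E p → ℝ) (hπ_meas : Measurable π) (hπ_nonneg : ∀ θ ∈ M.paramSpace, 0 ≤ π θ)
    (hπ_near : ∃ U ∈ 𝓝 θstar, ContinuousOn π U ∧ ∀ θ ∈ U, 0 < π θ)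
    (hpost : MPosterior.PosteriorExists P X M.paramSpace ρ π α)
    -- the weighted M-estimator
    (θhat : ℕ → Ω → MPosterior.E p)
    (hθhat : MPosterior.IsWeightedMEstimator P X M.paramSpace ψ α θhat)
    -- the two assumptions
    (V : Matrix (Fin p) (Fin p) ℝ) (hLAN : MPosterior.WeightedMLAN P X ρ α θstar V θhat)
    (hconc : MPosterior.ConcentratesAtRootN P X M.paramSpace ρ π α θstar) :
    TendstoInMeasure P
      (fun (n : ℕ) ω => MPosterior.tvDist
        (MPosterior.posterior M.paramSpace ρ π α n (fun i => X i ω))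
        (multivariateGaussian (θhat n ω) ((MPosterior.avgWeight α n * (n : ℝ))⁻¹ • V⁻¹)))
      atTop (fun _ => 0) := by
  open MPosterior in
  obtain ⟨hV, hLAN⟩ := hLAN
  rw [tendstoInMeasure_iff_dist]
  intro e he
  set ε : ℝ := min (1 / 8) (e / 6) with hεdef
  have hε : 0 < ε := by positivity
  have hε8 : ε ≤ 1 / 8 := min_le_left _ _
  have hεe : 5 * ε < e := by
    have : ε ≤ e / 6 := min_le_right _ _
    linarith
  -- Chosen so that the accumulated error factor exp(4η) equals 1 + ε.
  set η : ℝ := Real.log (1 + ε) / 4 with hηdef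
  have hη : 0 < η := div_pos (Real.log_pos (by linarith)) (by norm_num)
  have hexp : Real.exp (4 * η) = 1 + ε := by
    rw [hηdef, mul_div_cancel₀ _ (by norm_num), Real.exp_log (by linarith)]
  obtain ⟨ℓ, hℓ, htv⟩ := exists_tvDist_gaussian_le hV hε hε8
  obtain ⟨hπu, d, hd, hdΘ, hdπ⟩ := exists_closedBall_prior_bounds hθstar hπ_near hη
  have hXm : AEMeasurable (fun ω i => X i ω) P :=
    aemeasurable_pi_iff.2 fun i => (hX_law i).aemeasurable
  rw [ENNReal.tendsto_nhds_zero]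
  intro δ hδ
  have hδ3 : 0 < δ / 3 := ENNReal.div_pos hδ.ne' (by norm_num)
  -- An expected exterior mass of at most ε δ/3 leaves, by Markov, probability at most δ/3 that this
  -- mass reaches ε. Fixing r makes the ball of radius ℓ r a fixed compact set for the M-LAN
  -- condition.
  obtain ⟨r, hr, hrn⟩ := exists_eventually_le_of_forall_tendsto
    (F := fun n r => ∫⁻ ω, posterior M.paramSpace ρ π α n (fun i => X i ω)
      {θ | r < ‖√(n : ℝ) • (θ - θstar)‖} ∂P) hconc
    (ENNReal.mul_pos (ENNReal.ofReal_pos.2 hε).ne' hδ3.ne')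
  have hlarge : ∀ᶠ n : ℕ in atTop, ℓ * r / d ≤ √(n : ℝ) :=
    (Real.tendsto_sqrt_atTop.comp tendsto_natCast_atTop_atTop).eventually_ge_atTop _
  filter_upwards [hrn, hlarge, eventually_gt_atTop 0, ENNReal.tendsto_nhds_zero.1 hpost _ hδ3,
    ENNReal.tendsto_nhds_zero.1 (hLAN (Metric.closedBall 0 (ℓ * r)) (isCompact_closedBall _ _)
      (ENNReal.ofReal η) (ENNReal.ofReal_pos.2 hη)) _ hδ3] with n hn1 hn2 hn3 hn4 hn5
  have hs : 0 < √(n : ℝ) := Real.sqrt_pos.2 (by exact_mod_cast hn3)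
  have ha := avgWeight_pos hα.1 hn3
  have hset : {θ : E p | r < ‖√(n : ℝ) • (θ - θstar)‖} =
      (Metric.closedBall θstar (r / √(n : ℝ)))ᶜ := by
    ext θ
    rw [Set.mem_compl_iff, mem_closedBall_iff_norm, not_le, Set.mem_ofPred_eq, norm_smul,
      Real.norm_of_nonneg hs.le, div_lt_iff₀' hs]
  rw [hset] at hn1
  have hmark : P {ω | ENNReal.ofReal ε ≤ posterior M.paramSpace ρ π α n (fun i => X i ω)
      (Metric.closedBall θstar (r / √(n : ℝ)))ᶜ} ≤ δ / 3 := by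
    have hm := (measurable_posterior_apply M.paramSpace hρ hπ_meas α n
      (measurableSet_closedBall (x := θstar) (ε := r / √(n : ℝ))).compl).comp_aemeasurable hXm
    have h1 := (mul_meas_ge_le_lintegral₀ hm (ENNReal.ofReal ε)).trans hn1
    exact (ENNReal.mul_le_mul_iff_right (ENNReal.ofReal_pos.2 hε).ne' ENNReal.ofReal_ne_top).1 h1
  -- Off three exceptional events (infinite normaliser, large remainder, large exterior mass) the
  -- argument is deterministic and gives distance at most 5ε < e.
  calc _ ≤ P ({ω | normalizer M.paramSpace ρ π α n (fun i => X i ω) = ∞} ∪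
        {ω | ENNReal.ofReal η < ⨆ h ∈ Metric.closedBall 0 (ℓ * r),
          ‖lanRemainder ρ α θstar V n (fun i => X i ω) (θhat n ω) h‖ₑ} ∪
        {ω | ENNReal.ofReal ε ≤ posterior M.paramSpace ρ π α n (fun i => X i ω)
          (Metric.closedBall θstar (r / √(n : ℝ)))ᶜ}) := ?_
    _ ≤ δ / 3 + δ / 3 + δ / 3 :=
        (measure_union_le _ _).trans
          (add_le_add ((measure_union_le _ _).trans (add_le_add hn4 hn5)) hmark)
    _ = δ := ENNReal.add_thirds δ
  refine measure_mono fun ω hω => ?_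
  by_contra hgood
  simp only [Set.mem_union, Set.mem_ofPred_eq, not_or, not_lt, not_le] at hgood
  obtain ⟨⟨hg1, hg2⟩, hg3⟩ := hgood
  have h0 : normalizer M.paramSpace ρ π α n (fun i => X i ω) ≠ 0 :=
    normalizer_ne_zero hρ hπ_meas α n _ hd hdΘ fun θ hθ =>
      lt_of_lt_of_le (by positivity) (hdπ θ hθ).1
  have hprob := isProbabilityMeasure_posterior h0 hg1
  have hlan : ∀ h ∈ Metric.closedBall (0 : E p) (ℓ * r),
      |lanRemainder ρ α θstar V n (fun i => X i ω) (θhat n ω) h| ≤ η := by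
    intro h hh
    have := (le_iSup₂ (f := fun h (_ : h ∈ Metric.closedBall (0 : E p) (ℓ * r)) =>
      ‖lanRemainder ρ α θstar V n (fun i => X i ω) (θhat n ω) h‖ₑ) h hh).trans hg2
    rwa [Real.enorm_eq_ofReal_abs, ENNReal.ofReal_le_ofReal_iff hη.le] at this
  have hsub : Metric.closedBall θstar (ℓ * (r / √(n : ℝ))) ⊆ Metric.closedBall θstar d := by
    refine Metric.closedBall_subset_closedBall ?_
    rw [div_le_iff₀ hd] at hn2
    rw [← mul_div_assoc, div_le_iff₀ hs]
    linarith
  obtain ⟨m, hm⟩ := exists_posterior_nearly_proportional (t := θhat n ω) hV hn3 ha hρ hπ_meas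
    (d := ℓ * (r / √(n : ℝ))) (R := ℓ * r) (le_of_eq (by field_simp)) (hsub.trans hdΘ) hπu
    (fun θ hθ => hdπ θ (hsub hθ)) hlan h0 hg1
  rw [hexp] at hm
  have hle := htv θstar (θhat n ω) (r / √(n : ℝ)) (avgWeight α n * n) m _ (div_pos hr hs)
    (mul_pos ha (by exact_mod_cast hn3)) hm (by
      have h1 := ENNReal.toReal_mono ENNReal.ofReal_ne_top hg3.le
      rw [ENNReal.toReal_ofReal hε.le] at h1
      have h2 := probReal_compl_eq_one_sub (μ := posterior M.paramSpace ρ π α n (fun i => X i ω))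
        (measurableSet_closedBall (x := θstar) (ε := r / √(n : ℝ)))
      rw [measureReal_def] at h2
      linarith)
  rw [Set.mem_ofPred_eq, Real.dist_eq, sub_zero, abs_of_nonneg (tvDist_nonneg _ _)] at hω
  linarith
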